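/- **Theorem.** Let $G$ be a group. A subgroup $H$ of $G$ is called a *power subgroup* of $G$ if there is an integer $m\ge 0$ such that $H=G^m$, where $G^m=\langle g^m : g\in G\rangle$ is the subgroup generated by all $m$-th powers of elements of $G$; otherwise $H$ is called a *non-power subgroup* of $G$. Let $k$ be the number of non-power subgroups of $G$, with $k=\infty$ if there are infinitely many. Then: 1. $k=0$ if and only if $G$ is cyclic; 2. $0<k<\infty$ if and only if $G$ is finite and non-cyclic; 3. $k=\infty$ if and only if $G$ is infinite and non-cyclic. -/

import Mathlib

/-- The subgroup `G^m = ⟨g^m : g ∈ G⟩` generated by all `m`-th powers of elements of `G`. -/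
def powSubgroup (G : Type*) [Group G] (m : ℕ) : Subgroup G :=
  Subgroup.closure {x : G | ∃ g : G, g ^ m = x}

/-- `H` is a power subgroup of `G` if `H = G^m` for some non-negative integer `m`. -/
def IsPowerSubgroup {G : Type*} [Group G] (H : Subgroup G) : Prop :=
  ∃ m : ℕ, H = powSubgroup G m

/-- The number `k` of non-power subgroups of `G`, equal to `⊤` when there are infinitely many. -/
noncomputable def numNonPowerSubgroups (G : Type*) [Group G] : ℕ∞ :=
  {H : Subgroup G | ¬ IsPowerSubgroup H}.encard

/-!
Write `G^m` for `powSubgroup G m`. Every subgroup of a cyclic group is `G^m` for some `m`, so three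
things have to be shown for a group `G` with finitely many non-power subgroups.

*If `G` is finite and every subgroup is a power subgroup, then `G` is cyclic*
(`isCyclic_of_finite_of_forall_isPowerSubgroup`). Let `n` be the exponent of `G`. If `⟨x⟩ = G^a`,
then `n / gcd n a` is the exponent of `G^a`, that is, the order of `x`; as `G^a = G^(gcd n a)`, the
order of `x` determines the subgroup `⟨x⟩`. Hence `G` has at most `φ d` elements of order `d` for
every `d`, so at most `k` solutions of `g ^ k = 1` for every `k > 0`, which forces it to be cyclic.

*If `G` has finite exponent, then `G` is finite* (`finite_of_finite_nonPower_of_pow_eq_one`): there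
are only finitely many power subgroups, hence only finitely many subgroups, and a torsion group with
finitely many cyclic subgroups is finite.

*If `G` is infinite, then `G` is cyclic* (`isCyclic_of_finite_nonPower_of_infinite`). An infinite
torsion group has infinitely many cyclic subgroups, so a nontrivial one of them would be `G^m` with
`m ≠ 0`; then `G` would have finite exponent. So there is an element `x` of infinite order, and some
power `c ≠ 1` of it satisfies `⟨c⟩ = G^M` with `M ≠ 0`. The group `G` is torsion-free: for `t ≠ 1`
of finite order the infinitely many subgroups `⟨t⟩⟨c ^ (k M)⟩`, `k ≥ 0`, are all non-power, because
`G^m = ⟨t⟩⟨c ^ (k M)⟩` gives `c ^ m ∈ ⟨c ^ (k M)⟩`, so `M ∣ m` and `t ∈ G^M = ⟨c⟩`. Since `g`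
commutes with `g ^ M`, a nontrivial power of `c`, the subgroup `⟨c⟩` is central. The quotient
`G ⧸ ⟨c⟩` inherits the hypothesis and has exponent dividing `M`, so it is finite. The transfer
`g ↦ g ^ [G : Z(G)]` is then an embedding of the torsion-free group `G` into its centre, so `G` is
abelian, and `g ↦ g ^ M` embeds it into the cyclic group `⟨c⟩`.
-/

/-! ### Power subgroups -/

section PowSubgroup

variable {G : Type*} [Group G]

lemma pow_mem_powSubgroup (g : G) (m : ℕ) : g ^ m ∈ powSubgroup G m :=
  Subgroup.subset_closure ⟨g, rfl⟩

lemma powSubgroup_le_iff {m : ℕ} {H : Subgroup G} :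
    powSubgroup G m ≤ H ↔ ∀ g : G, g ^ m ∈ H := by
  refine ⟨fun h g => h (pow_mem_powSubgroup g m), fun h => ?_⟩
  refine (Subgroup.closure_le H).2 ?_
  rintro _ ⟨g, rfl⟩
  exact h g

lemma powSubgroup_zero : powSubgroup G 0 = ⊥ :=
  le_bot_iff.1 (powSubgroup_le_iff.2 fun g => by simp)

lemma powSubgroup_le_of_dvd {a b : ℕ} (h : a ∣ b) : powSubgroup G b ≤ powSubgroup G a := by
  obtain ⟨k, rfl⟩ := h
  refine powSubgroup_le_iff.2 fun g => ?_
  rw [mul_comm, pow_mul]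
  exact pow_mem_powSubgroup _ _

lemma normal_powSubgroup (m : ℕ) : (powSubgroup G m).Normal := by
  refine ⟨fun n hn g => ?_⟩
  have : powSubgroup G m ≤ (powSubgroup G m).comap (MulAut.conj g).toMonoidHom :=
    powSubgroup_le_iff.2 fun y => by
      rw [Subgroup.mem_comap, map_pow]
      exact pow_mem_powSubgroup _ _
  simpa using this hn

lemma map_powSubgroup {K : Type*} [Group K] (f : G →* K) (hf : Function.Surjective f) (m : ℕ) :
    (powSubgroup G m).map f = powSubgroup K m := by
  refine le_antisymm (Subgroup.map_le_iff_le_comap.2 (powSubgroup_le_iff.2 fun g => ?_))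
    (powSubgroup_le_iff.2 fun k => ?_)
  · rw [Subgroup.mem_comap, map_pow]
    exact pow_mem_powSubgroup _ _
  · obtain ⟨g, rfl⟩ := hf k
    exact ⟨g ^ m, pow_mem_powSubgroup g m, map_pow f g m⟩

lemma powSubgroup_gcd {n : ℕ} (hn : ∀ g : G, g ^ n = 1) (a : ℕ) :
    powSubgroup G (n.gcd a) = powSubgroup G a := by
  refine le_antisymm (powSubgroup_le_iff.2 fun g => ?_)
    (powSubgroup_le_of_dvd (Nat.gcd_dvd_right n a))
  have : g ^ n.gcd a = (g ^ a) ^ n.gcdB a := by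
    rw [← zpow_natCast, Nat.gcd_eq_gcd_ab, zpow_add, zpow_mul, zpow_mul, zpow_natCast, zpow_natCast,
      hn, one_zpow, one_mul]
  rw [this]
  exact zpow_mem (pow_mem_powSubgroup g a) _

lemma isPowerSubgroup_of_isCyclic [IsCyclic G] (H : Subgroup G) : IsPowerSubgroup H := by
  obtain ⟨g, hg⟩ := IsCyclic.exists_generator (α := G)
  obtain ⟨h, rfl⟩ := (Subgroup.isCyclic_iff_exists_zpowers_eq_top H).1 inferInstance
  obtain ⟨k, rfl⟩ := Subgroup.mem_zpowers_iff.1 (hg h)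
  refine ⟨k.natAbs, le_antisymm ?_ (powSubgroup_le_iff.2 fun y => ?_)⟩
  · rw [Subgroup.zpowers_le]
    obtain hk | hk := Int.natAbs_eq k
    · rw [hk, zpow_natCast]
      exact pow_mem_powSubgroup g _
    · rw [hk, zpow_neg, zpow_natCast, Int.natAbs_neg, Int.natAbs_natCast]
      exact inv_mem (pow_mem_powSubgroup g _)
  · obtain ⟨j, rfl⟩ := Subgroup.mem_zpowers_iff.1 (hg y)
    rw [← zpow_natCast, ← zpow_mul, mul_comm]
    obtain ⟨l, hl⟩ : k ∣ (k.natAbs : ℤ) := Int.dvd_natAbs_self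
    rw [hl, mul_assoc, zpow_mul]
    exact zpow_mem (Subgroup.mem_zpowers _) _

end PowSubgroup

/-! ### Finite groups all of whose subgroups are power subgroups -/

section Finite

variable {G : Type*} [Group G]

/-- If `⟨x⟩ = G^a`, then the exponent of `G^a` is the order of `x`. -/
lemma exponent_dvd_mul_iff_of_zpowers_eq {x : G} {a : ℕ}
    (h : Subgroup.zpowers x = powSubgroup G a) (e : ℕ) :
    Monoid.exponent G ∣ a * e ↔ orderOf x ∣ e := by
  rw [Monoid.exponent_dvd_iff_forall_pow_eq_one, orderOf_dvd_iff_pow_eq_one]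
  refine ⟨fun H => ?_, fun H g => ?_⟩
  · have key : ∀ z ∈ powSubgroup G a, z ^ e = 1 := by
      intro z hz
      induction hz using Subgroup.closure_induction with
      | mem z hz =>
        obtain ⟨g, rfl⟩ := hz
        rw [← pow_mul, H]
      | one => exact one_pow e
      | mul y z hy hz ihy ihz =>
        have hy' : y ∈ Subgroup.zpowers x := h ▸ hy
        have hz' : z ∈ Subgroup.zpowers x := h ▸ hz
        obtain ⟨i, rfl⟩ := hy'
        obtain ⟨j, rfl⟩ := hz'
        have hc : Commute (x ^ i) (x ^ j) := Commute.zpow_zpow_self x i j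
        exact (hc.mul_pow e).trans (by simpa using congrArg₂ (· * ·) ihy ihz)
      | inv y _ ih => rw [inv_pow, ih, inv_one]
    exact key x (h ▸ Subgroup.mem_zpowers x)
  · have hg : g ^ a ∈ Subgroup.zpowers x := h ▸ pow_mem_powSubgroup g a
    obtain ⟨i, hi⟩ := Subgroup.mem_zpowers_iff.1 hg
    rw [pow_mul, ← hi, ← zpow_natCast, ← zpow_mul, mul_comm, zpow_mul, zpow_natCast, H, one_zpow]

/-- A cyclic power subgroup is determined by its order. -/
lemma zpowers_eq_powSubgroup_exponent_div (hG : Monoid.exponent G ≠ 0) {x : G}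
    (hx : IsPowerSubgroup (Subgroup.zpowers x)) :
    Subgroup.zpowers x = powSubgroup G (Monoid.exponent G / orderOf x) := by
  obtain ⟨a, ha⟩ := hx
  have key := exponent_dvd_mul_iff_of_zpowers_eq ha
  set n := Monoid.exponent G
  have hpos : 0 < n.gcd a := Nat.gcd_pos_of_pos_left _ (Nat.pos_of_ne_zero hG)
  have hd : orderOf x = n / n.gcd a := by
    refine Nat.dvd_antisymm ((key _).1 ?_) ?_
    · rw [← Nat.mul_div_assoc _ (Nat.gcd_dvd_left n a), mul_comm,
        Nat.mul_div_assoc _ (Nat.gcd_dvd_right n a)]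
      exact dvd_mul_right _ _
    · refine (Nat.coprime_div_gcd_div_gcd hpos).dvd_of_dvd_mul_left (m := a / n.gcd a) ?_
      have h1 := (key _).2 dvd_rfl
      rw [← Nat.mul_div_right_comm (Nat.gcd_dvd_right n a)]
      exact Nat.div_dvd_div (Nat.gcd_dvd_left n a) h1
  rw [hd, Nat.div_div_self (Nat.gcd_dvd_left n a) hG,
    powSubgroup_gcd Monoid.pow_exponent_eq_one, ha]

lemma isCyclic_of_finite_of_forall_isPowerSubgroup [Finite G]
    (h : ∀ H : Subgroup G, IsPowerSubgroup H) : IsCyclic G := by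
  classical
  have := Fintype.ofFinite G
  -- All elements of order `d` lie in one cyclic group of order `d`.
  have hle : ∀ d : ℕ, (Finset.univ.filter fun g : G => orderOf g = d).card ≤ d.totient := by
    intro d
    by_cases hd : ∃ x : G, orderOf x = d
    · obtain ⟨x, rfl⟩ := hd
      have hc : orderOf x ∣ Fintype.card (Subgroup.zpowers x) := by
        rw [Fintype.card_zpowers]
      rw [← IsCyclic.card_orderOf_eq_totient hc,
        ← Finset.card_map (Function.Embedding.subtype _)]
      refine Finset.card_le_card fun y hy => ?_
      have hy' : orderOf y = orderOf x := (Finset.mem_filter.1 hy).2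
      have hyx : y ∈ Subgroup.zpowers x := by
        rw [zpowers_eq_powSubgroup_exponent_div Monoid.exponent_ne_zero_of_finite (h _), ← hy',
          ← zpowers_eq_powSubgroup_exponent_div Monoid.exponent_ne_zero_of_finite (h _)]
        exact Subgroup.mem_zpowers y
      simp only [Finset.mem_map, Finset.mem_filter, Finset.mem_univ, true_and]
      exact ⟨⟨y, hyx⟩, by rw [Subgroup.orderOf_mk, hy'], rfl⟩
    · rw [Finset.filter_false_of_mem fun y _ hy => hd ⟨y, hy⟩]
      simp
  refine isCyclic_of_card_pow_eq_one_le fun k hk => ?_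
  have hsum := (sum_card_orderOf_eq_card_pow_eq_one (G := G) hk.ne').symm.le.trans
    ((Finset.sum_le_sum fun d _ => hle d).trans (Nat.sum_totient k).le)
  convert hsum

end Finite

/-! ### Torsion groups -/

section Torsion

variable {G : Type*} [Group G]

lemma finite_of_finite_range_zpowers (ht : ∀ g : G, IsOfFinOrder g)
    (hf : (Set.range fun g : G => Subgroup.zpowers g).Finite) : Finite G := by
  refine Set.finite_univ_iff.1
    ((hf.biUnion (t := fun H : Subgroup G => {g | Subgroup.zpowers g = H}) ?_).subset ?_)
  · rintro _ ⟨x, rfl⟩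
    refine (ht x).finite_zpowers.subset fun g (hg : Subgroup.zpowers g = Subgroup.zpowers x) => ?_
    rw [← hg]
    exact Subgroup.mem_zpowers g
  · exact fun g _ => Set.mem_biUnion (Set.mem_range_self g) rfl

lemma finite_of_finite_nonPower_of_pow_eq_one
    (hS : {H : Subgroup G | ¬ IsPowerSubgroup H}.Finite) {n : ℕ} (hn : n ≠ 0)
    (h : ∀ g : G, g ^ n = 1) : Finite G := by
  have hP : {H : Subgroup G | IsPowerSubgroup H}.Finite := by
    refine ((Set.finite_Iic n).image (powSubgroup G)).subset ?_
    rintro _ ⟨m, rfl⟩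
    exact ⟨n.gcd m, Nat.gcd_le_left m (Nat.pos_of_ne_zero hn), powSubgroup_gcd h m⟩
  refine finite_of_finite_range_zpowers
    (fun g => isOfFinOrder_iff_pow_eq_one.2 ⟨n, Nat.pos_of_ne_zero hn, h g⟩)
    ((hP.union hS).subset fun H _ => em _)

lemma finite_of_finite_nonPower_of_isOfFinOrder
    (hS : {H : Subgroup G | ¬ IsPowerSubgroup H}.Finite) (ht : ∀ g : G, IsOfFinOrder g) :
    Finite G := by
  by_cases hf : (Set.range fun g : G => Subgroup.zpowers g).Finite
  · exact finite_of_finite_range_zpowers ht hf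
  obtain ⟨_, ⟨x, rfl⟩, hx⟩ := Set.Infinite.exists_notMem_finite hf
    (hS.union (Set.finite_singleton ⊥))
  simp only [Set.mem_union, Set.mem_ofPred_eq, Set.mem_singleton_iff, not_or, not_not] at hx
  obtain ⟨⟨m, hm⟩, hbot⟩ := hx
  have hm0 : m ≠ 0 := by
    rintro rfl
    exact hbot (hm.trans powSubgroup_zero)
  refine finite_of_finite_nonPower_of_pow_eq_one hS
    (mul_ne_zero hm0 (ht x).orderOf_pos.ne') fun g => ?_
  exact Monoid.exponent_dvd_iff_forall_pow_eq_one.1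
    ((exponent_dvd_mul_iff_of_zpowers_eq hm (orderOf x)).2 dvd_rfl) g

end Torsion

/-! ### Groups with an element of infinite order -/

section Infinite

variable {G : Type*} [Group G]

/-- The preimage in `G` of a non-power subgroup of a quotient is again non-power. -/
lemma finite_nonPower_quotient (hS : {H : Subgroup G | ¬ IsPowerSubgroup H}.Finite)
    (N : Subgroup G) [N.Normal] : {H : Subgroup (G ⧸ N) | ¬ IsPowerSubgroup H}.Finite := by
  have hsurj := QuotientGroup.mk'_surjective N
  refine Set.Finite.of_finite_image (f := Subgroup.comap (QuotientGroup.mk' N)) (hS.subset ?_)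
    (Subgroup.comap_injective hsurj).injOn
  rintro _ ⟨H, hH, rfl⟩ ⟨m, hm⟩
  refine hH ⟨m, ?_⟩
  rw [← map_powSubgroup _ hsurj, ← hm, Subgroup.map_comap_eq_self_of_surjective hsurj]

lemma mem_zpowers_pow_iff_dvd {c : G} (hc : ¬ IsOfFinOrder c) (k : ℕ) (m : ℤ) :
    c ^ m ∈ Subgroup.zpowers (c ^ k) ↔ (k : ℤ) ∣ m := by
  rw [Subgroup.mem_zpowers_iff]
  refine exists_congr fun j => ?_
  rw [← zpow_natCast, ← zpow_mul, (injective_zpow_iff_not_isOfFinOrder.2 hc).eq_iff, eq_comm]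

lemma zpowers_pow_injective {c : G} (hc : ¬ IsOfFinOrder c) :
    Function.Injective fun k : ℕ => Subgroup.zpowers (c ^ k) := by
  intro i j (hij : Subgroup.zpowers (c ^ i) = Subgroup.zpowers (c ^ j))
  have h1 : c ^ (i : ℤ) ∈ Subgroup.zpowers (c ^ j) := by
    rw [← hij, zpow_natCast]
    exact Subgroup.mem_zpowers _
  have h2 : c ^ (j : ℤ) ∈ Subgroup.zpowers (c ^ i) := by
    rw [hij, zpow_natCast]
    exact Subgroup.mem_zpowers _
  rw [mem_zpowers_pow_iff_dvd hc] at h1 h2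
  exact Nat.dvd_antisymm (Int.natCast_dvd_natCast.1 h2) (Int.natCast_dvd_natCast.1 h1)

lemma eq_one_of_isOfFinOrder_of_mem_zpowers {c t : G} (hc : ¬ IsOfFinOrder c)
    (ht : IsOfFinOrder t) (h : t ∈ Subgroup.zpowers c) : t = 1 := by
  obtain ⟨k, rfl⟩ := Subgroup.mem_zpowers_iff.1 h
  obtain ⟨r, hr, hk⟩ := isOfFinOrder_iff_pow_eq_one.1 ht
  rw [← zpow_natCast, ← zpow_mul] at hk
  have h0 : k * (r : ℤ) = 0 :=
    injective_zpow_iff_not_isOfFinOrder.2 hc (hk.trans (zpow_zero c).symm)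
  obtain h0 | h0 := mul_eq_zero.1 h0
  · rw [h0, zpow_zero]
  · omega

lemma normal_zpowers_pow {c : G} (hc : (Subgroup.zpowers c).Normal) (k : ℕ) :
    (Subgroup.zpowers (c ^ k)).Normal := by
  refine ⟨fun a ha g => ?_⟩
  obtain ⟨j, rfl⟩ := Subgroup.mem_zpowers_iff.1 ha
  obtain ⟨e, he⟩ := Subgroup.mem_zpowers_iff.1 (hc.conj_mem c (Subgroup.mem_zpowers c) g)
  refine Subgroup.mem_zpowers_iff.2 ⟨e * j, ?_⟩
  rw [← conj_zpow, ← conj_pow, ← he, zpow_mul, ← zpow_natCast (c ^ e), ← zpow_mul c e,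
    mul_comm e, zpow_mul, zpow_natCast]

/-- Dedekind's modular law for `⟨t⟩⟨c ^ k⟩`, where `⟨t⟩` meets `⟨c⟩` trivially. -/
lemma zpowers_sup_zpowers_pow_inf {c t : G} (hcn : (Subgroup.zpowers c).Normal)
    (hc : ¬ IsOfFinOrder c) (ht : IsOfFinOrder t) (k : ℕ) :
    (Subgroup.zpowers t ⊔ Subgroup.zpowers (c ^ k)) ⊓ Subgroup.zpowers c =
      Subgroup.zpowers (c ^ k) := by
  have hle : Subgroup.zpowers (c ^ k) ≤ Subgroup.zpowers c :=
    Subgroup.zpowers_le.2 (pow_mem (Subgroup.mem_zpowers c) k)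
  refine le_antisymm ?_ (le_inf le_sup_right hle)
  rintro y ⟨hy, hyc⟩
  have := normal_zpowers_pow hcn k
  obtain ⟨u, hu, v, hv, rfl⟩ := Subgroup.mem_sup_of_normal_right.1 hy
  have huc : u ∈ Subgroup.zpowers c := (Subgroup.mul_mem_cancel_right _ (hle hv)).1 hyc
  obtain ⟨i, rfl⟩ := Subgroup.mem_zpowers_iff.1 hu
  rw [eq_one_of_isOfFinOrder_of_mem_zpowers hc ht.zpow huc, one_mul]
  exact hv

/-- If finitely many subgroups are non-power and some `G^M` with `M ≠ 0` is infinite cyclic, then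
`G` is torsion-free. -/
lemma eq_one_of_isOfFinOrder_of_zpowers_eq
    (hS : {H : Subgroup G | ¬ IsPowerSubgroup H}.Finite) {c : G} {M : ℕ}
    (hc : ¬ IsOfFinOrder c) (hM : M ≠ 0) (hcM : Subgroup.zpowers c = powSubgroup G M)
    {t : G} (ht : IsOfFinOrder t) : t = 1 := by
  by_contra ht1
  have hcn : (Subgroup.zpowers c).Normal := hcM ▸ normal_powSubgroup M
  let D : ℕ → Subgroup G := fun k => Subgroup.zpowers t ⊔ Subgroup.zpowers (c ^ (k * M))
  have hinf : ∀ k, D k ⊓ Subgroup.zpowers c = Subgroup.zpowers (c ^ (k * M)) :=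
    fun k => zpowers_sup_zpowers_pow_inf hcn hc ht (k * M)
  have hinj : Function.Injective D := by
    intro i j hij
    refine Nat.eq_of_mul_eq_mul_right (Nat.pos_of_ne_zero hM) (zpowers_pow_injective hc ?_)
    change Subgroup.zpowers _ = Subgroup.zpowers _
    rw [← hinf, ← hinf, hij]
  refine Set.infinite_range_of_injective hinj (hS.subset ?_)
  rintro _ ⟨k, rfl⟩ ⟨m, hm⟩
  have hcm : c ^ (m : ℤ) ∈ Subgroup.zpowers (c ^ (k * M)) := by
    rw [← hinf, hm, zpow_natCast]
    exact ⟨pow_mem_powSubgroup c m, pow_mem (Subgroup.mem_zpowers c) m⟩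
  rw [mem_zpowers_pow_iff_dvd hc, Int.natCast_dvd_natCast] at hcm
  have htD : t ∈ D k := Subgroup.mem_sup_left (Subgroup.mem_zpowers t)
  rw [hm] at htD
  refine ht1 (eq_one_of_isOfFinOrder_of_mem_zpowers hc ht ?_)
  rw [hcM]
  exact powSubgroup_le_of_dvd ((dvd_mul_left M k).trans hcm) htD

/-- In a torsion-free group, an element `c` generating `G^M` commutes with every `g`: the conjugate
of `c` by `g` is some `c ^ e`, and `e = 1` because `g` commutes with `g ^ M`, which is a nontrivial
power of `c`. -/
lemma mem_center_of_zpowers_eq_powSubgroup (htf : ∀ g : G, IsOfFinOrder g → g = 1) {c : G} {M : ℕ}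
    (hc : ¬ IsOfFinOrder c) (hM : M ≠ 0) (hcM : Subgroup.zpowers c = powSubgroup G M) :
    c ∈ Subgroup.center G := by
  have hcn : (Subgroup.zpowers c).Normal := hcM ▸ normal_powSubgroup M
  refine Subgroup.mem_center_iff.2 fun g => ?_
  by_cases hg : g = 1
  · simp [hg]
  obtain ⟨e, he⟩ := Subgroup.mem_zpowers_iff.1 (hcn.conj_mem c (Subgroup.mem_zpowers c) g)
  have hgM : g ^ M ∈ Subgroup.zpowers c := hcM ▸ pow_mem_powSubgroup g M
  obtain ⟨k, hk⟩ := Subgroup.mem_zpowers_iff.1 hgM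
  have hk0 : k ≠ 0 := by
    rintro rfl
    rw [zpow_zero] at hk
    exact hg (htf g (isOfFinOrder_iff_pow_eq_one.2 ⟨M, Nat.pos_of_ne_zero hM, hk.symm⟩))
  have hek : c ^ (e * k) = c ^ k := by
    rw [zpow_mul, he, conj_zpow, hk, ← pow_succ', pow_succ, mul_inv_cancel_right]
  have he1 : e = 1 :=
    mul_right_cancel₀ hk0 ((injective_zpow_iff_not_isOfFinOrder.2 hc hek).trans (one_mul k).symm)
  rw [he1, zpow_one] at he
  exact (eq_mul_inv_iff_mul_eq.1 he).symm

lemma isCyclic_of_finite_nonPower_of_infinite [Infinite G]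
    (hS : {H : Subgroup G | ¬ IsPowerSubgroup H}.Finite) : IsCyclic G := by
  obtain ⟨x, hx⟩ : ∃ x : G, ¬ IsOfFinOrder x := by
    by_contra! ht
    exact not_finite_iff_infinite.2 ‹_› (finite_of_finite_nonPower_of_isOfFinOrder hS ht)
  obtain ⟨_, ⟨i, rfl⟩, hi⟩ :=
    (Set.infinite_range_of_injective (zpowers_pow_injective hx)).exists_notMem_finite
      (hS.union (Set.finite_singleton ⊥))
  simp only [Set.mem_union, Set.mem_ofPred_eq, Set.mem_singleton_iff, not_or, not_not] at hi
  obtain ⟨⟨M, hcM⟩, hbot⟩ := hi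
  have hM : M ≠ 0 := by
    rintro rfl
    exact hbot (hcM.trans powSubgroup_zero)
  have hc : ¬ IsOfFinOrder (x ^ i) := fun h =>
    hbot (Subgroup.zpowers_eq_bot.2 (eq_one_of_isOfFinOrder_of_mem_zpowers hx h
      (pow_mem (Subgroup.mem_zpowers x) i)))
  generalize x ^ i = c at hcM hbot hc
  have htf : ∀ g : G, IsOfFinOrder g → g = 1 := fun g hg =>
    eq_one_of_isOfFinOrder_of_zpowers_eq hS hc hM hcM hg
  have hpow : ∀ {n : ℕ}, n ≠ 0 → ∀ g : G, g ^ n = 1 → g = 1 := fun hn g hg =>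
    htf g (isOfFinOrder_iff_pow_eq_one.2 ⟨_, Nat.pos_of_ne_zero hn, hg⟩)
  -- The quotient by the central subgroup `⟨c⟩` has exponent dividing `M`, so it is finite.
  have hfin : (Subgroup.center G).FiniteIndex := by
    have hcn : (Subgroup.zpowers c).Normal := hcM ▸ normal_powSubgroup M
    have : Finite (G ⧸ Subgroup.zpowers c) := by
      refine finite_of_finite_nonPower_of_pow_eq_one (finite_nonPower_quotient hS _) hM fun q => ?_
      obtain ⟨g, rfl⟩ := QuotientGroup.mk_surjective q
      rw [← QuotientGroup.mk_pow, QuotientGroup.eq_one_iff, hcM]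
      exact pow_mem_powSubgroup g M
    have := Subgroup.finiteIndex_of_finite_quotient (H := Subgroup.zpowers c)
    exact Subgroup.finiteIndex_of_le
      (Subgroup.zpowers_le.2 (mem_center_of_zpowers_eq_powSubgroup htf hc hM hcM))
  have htransfer : Function.Injective (MonoidHom.transferCenterPow G) :=
    (injective_iff_map_eq_one _).2 fun g hg => hpow hfin.index_ne_zero g (congrArg Subtype.val hg)
  have hcomm : ∀ a b : G, a * b = b * a := fun a b =>
    htransfer <| by
      rw [map_mul, map_mul]
      exact Subtype.ext (Subgroup.mem_center_iff.1 (MonoidHom.transferCenterPow G b).2 _)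
  let f : G →* Subgroup.zpowers c :=
    { toFun := fun g => ⟨g ^ M, hcM ▸ pow_mem_powSubgroup g M⟩
      map_one' := Subtype.ext (one_pow M)
      map_mul' := fun a b => Subtype.ext (Commute.mul_pow (hcomm a b) M) }
  exact isCyclic_of_injective f
    ((injective_iff_map_eq_one _).2 fun g hg => hpow hM g (congrArg Subtype.val hg))

end Infinite

/-! ### The number of non-power subgroups -/

lemma numNonPowerSubgroups_eq_zero_iff (G : Type*) [Group G] :
    numNonPowerSubgroups G = 0 ↔ IsCyclic G := by
  rw [numNonPowerSubgroups, Set.encard_eq_zero]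
  refine ⟨fun h => ?_, fun _ => ?_⟩
  · obtain _ | _ := finite_or_infinite G
    · exact isCyclic_of_finite_of_forall_isPowerSubgroup fun H =>
        not_not.1 (Set.eq_empty_iff_forall_notMem.1 h H)
    · exact isCyclic_of_finite_nonPower_of_infinite (h ▸ Set.finite_empty)
  · exact Set.eq_empty_iff_forall_notMem.2 fun H hH => hH (isPowerSubgroup_of_isCyclic H)

lemma numNonPowerSubgroups_lt_top_iff (G : Type*) [Group G] :
    numNonPowerSubgroups G < ⊤ ↔ (Finite G ∨ IsCyclic G) := by
  refine ⟨fun h => ?_, ?_⟩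
  · obtain hG | _ := finite_or_infinite G
    · exact Or.inl hG
    · exact Or.inr (isCyclic_of_finite_nonPower_of_infinite (Set.encard_lt_top_iff.1 h))
  · rintro (_ | h)
    · exact Set.encard_lt_top_iff.2 (Set.toFinite _)
    · rw [(numNonPowerSubgroups_eq_zero_iff G).2 h]
      exact WithTop.top_pos

theorem mainTheorem1 (G : Type*) [Group G] :
    (numNonPowerSubgroups G = 0 ↔ IsCyclic G) ∧
    ((0 < numNonPowerSubgroups G ∧ numNonPowerSubgroups G < ⊤) ↔ (Finite G ∧ ¬ IsCyclic G)) ∧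
    (numNonPowerSubgroups G = ⊤ ↔ (Infinite G ∧ ¬ IsCyclic G)) := by
  refine ⟨numNonPowerSubgroups_eq_zero_iff G, ?_, ?_⟩
  · rw [pos_iff_ne_zero, Ne, numNonPowerSubgroups_eq_zero_iff, numNonPowerSubgroups_lt_top_iff]
    tauto
  · rw [← not_lt_top_iff, numNonPowerSubgroups_lt_top_iff, not_or, not_finite_iff_infinite]
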